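/- All vector spaces, algebras and coalgebras are over a field $\Bbbk$; $\otimes=\otimes_\Bbbk$, $\imath$ denotes identity maps and $\tau$ flips. For an algebra $B$, not necessarily unital, $M(B)$ denotes its multiplier algebra. **(H) Hopf algebra notion.** Let $A$ be a Hopf algebra and $Y$ a coalgebra. A linear map $\rho:Y\to A\otimes Y$ makes $Y$ a *partial $A$-comodule coalgebra* if (H1) $(\varepsilon_A\otimes\imath_Y)\rho=\imath_Y$; (H2) $(\imath_A\otimes\Delta_Y)\rho=(m_A\otimes\imath_Y\otimes\imath_Y)(\imath_A\otimes\tau_{Y,A}\otimes\imath_Y)(\rho\otimes\rho)\Delta_Y$; (H3) $(\imath_A\otimes\rho)\rho=(m_A\otimes\imath_A\otimes\imath_Y)\{(\imath_A\otimes\varepsilon_Y)\rho\otimes[(\Delta_A\otimes\imath_Y)\rho]\}\Delta_Y$. It is *symmetric* if moreover (H4) $(\imath_A\otimes\rho)\rho=(m_A\otimes\imath_A\otimes\imath_Y)(\imath_A\otimes\tau_{A\otimes Y,A})\{[(\Delta_A\otimes\imath_Y)\rho]\otimes(\imath_A\otimes\varepsilon_Y)\rho\}\Delta_Y$. **(M)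 Multiplier notion.** Let $A$ and $Y$ be multiplier Hopf algebras, with comultiplications $\Delta_A:A\to M(A\otimes A)$, $\Delta_Y:Y\to M(Y\otimes Y)$ such that the products $\Delta(b)(1\otimes c)$, $\Delta(b)(c\otimes1)$, $(1\otimes c)\Delta(b)$, $(c\otimes1)\Delta(b)$ lie in the tensor square. A linear map $\rho:Y\to M(A\otimes Y)$ makes $Y$ a *partial $A$-comodule coalgebra* if $T(y\otimes a)=\rho(y)(a\otimes1)$ defines a linear map $T:Y\otimes A\to A\otimes Y$ and, for all $y,y'\in Y$, $a\in A$, (M1) $(\varepsilon_A\otimes\imath_Y)\rho(y)=y$, where $\varepsilon_A\otimes\imath_Y$ is extended to $M(A\otimes Y)$; (M2) $((\imath_Y\otimes T)(\Delta_Y(y)\otimes a))(1\otimes1\otimes y')$ and $(1\otimes1\otimes y')((\imath_Y\otimes T)(\Delta_Y(y)\otimes a))$ lie in $Y\otimes A\otimes Y$; (M3) $(\imath_A\otimes\Delta_Y)T=(T\otimes\imath_Y)(\imath_Y\otimes T)(\Delta_Y\otimes\imath_A)$; (M4) $(\imath_A\otimes T)(T\otimes\imath_A)(\imath_Y\otimes\Delta_A)=((\imath_A\otimes\varepsilon_Y)T\otimes\imath_A\otimes\imath_Y)(\imath_Y\otimes(\Delta_A\otimes\imath_Y)T)(\Delta_Y\otimes\imath_A)$.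 It is *symmetric* if moreover $\overline T(a\otimes y)=(a\otimes1)\rho(y)$ defines a linear map $\overline T:A\otimes Y\to A\otimes Y$ and (M5) $(\overline T\otimes\imath_Y)(a\otimes\Delta_Y(y))(1\otimes y'\otimes1)\in A\otimes Y\otimes Y$ for all $a\in A$, $y,y'\in Y$; (M6) $(\imath_A\otimes\overline T)(\imath_A\otimes\tau_{Y,A})(\overline T\otimes\imath_A)(\imath_A\otimes\tau_{A,Y})(\Delta_A\otimes\imath_Y)=((\imath_A\otimes\varepsilon_Y)\overline T\otimes\imath_A\otimes\imath_Y)(\imath_A\otimes\tau_{A\otimes Y,Y})((\Delta_A\otimes\imath_Y)\overline T\otimes\imath_Y)(\imath_A\otimes\Delta_Y)$. Here expressions in which $\Delta_A$ or $\Delta_Y$ occurs without a covering factor are multipliers. They are read after multiplication by algebra elements: (M2) by $(v\otimes1\otimes1)$, $v\in Y$, on either side; (M3) by $(1\otimes1\otimes y')$, $y'\in Y$, on either side; (M4) by $(1\otimes a'\otimes y')$ on the right; (M5) by $(1\otimes1\otimes v)$ on either side; (M6) by $(1\otimes a'\otimes1)$ on the left and $(1\otimes1\otimes y')$ on the right.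 **Proposition.** Let $A$ and $Y$ be (unital) Hopf algebras over $\Bbbk$, regarded as multiplier Hopf algebras through the canonical embeddings $A\otimes A\to M(A\otimes A)$ and $Y\otimes Y\to M(Y\otimes Y)$. Then (H) and (M) are equivalent. That is, composition with the canonical embedding $\jmath:A\otimes Y\to M(A\otimes Y)$ is a bijection from the linear maps $Y\to A\otimes Y$ onto the linear maps $Y\to M(A\otimes Y)$; a linear map $\rho:Y\to A\otimes Y$ makes $Y$ a partial (respectively symmetric partial) $A$-comodule coalgebra in the sense of (H) if and only if $\jmath\rho$ does so in the sense of (M); and, in particular, $Y$ is a partial (respectively symmetric partial) $A$-comodule coalgebra in the sense of (H) if and only if it is one in the sense of (M). -/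

import Mathlib

open scoped TensorProduct

noncomputable section

/-! ### Multipliers of a (possibly non-unital) algebra -/

section Multipliers

variable (k : Type*) [Field k]
variable (A : Type*) [NonUnitalRing A] [Module k A] [SMulCommClass k A A] [IsScalarTower k A A]
variable (B : Type*) [NonUnitalRing B] [Module k B] [SMulCommClass k B B] [IsScalarTower k B B]

/-- The pairs `(X, X')` of linear endomorphisms of `A` with `a * X b = X' a * b` for all `a, b`. -/
def multiplierSubmodule : Submodule k ((A →ₗ[k] A) × (A →ₗ[k] A)) where
  carrier := {X | ∀ a b : A, a * X.1 b = X.2 a * b}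
  add_mem' := by
    intro X Y hX hY a b
    simp only [Set.mem_ofPred_eq] at hX hY
    simp [mul_add, add_mul, hX, hY]
  zero_mem' := by
    intro a b
    simp
  smul_mem' := by
    intro c X hX a b
    simp only [Set.mem_ofPred_eq] at hX
    simp [mul_smul_comm, smul_mul_assoc, hX]

/-- The multiplier algebra `M(A)`. -/
def MultiplierAlgebra : Type _ := multiplierSubmodule k A

namespace MultiplierAlgebra

instance : AddCommGroup (MultiplierAlgebra k A) :=
  inferInstanceAs (AddCommGroup (multiplierSubmodule k A))

instance : Module k (MultiplierAlgebra k A) :=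
  inferInstanceAs (Module k (multiplierSubmodule k A))

variable {k A B}

/-- `z ↦ X z`. -/
def left (X : MultiplierAlgebra k A) : A →ₗ[k] A := X.1.1

/-- `z ↦ z X`. -/
def right (X : MultiplierAlgebra k A) : A →ₗ[k] A := X.1.2

theorem compat (X : MultiplierAlgebra k A) (a b : A) : a * X.left b = X.right a * b := X.2 a b

theorem ext {X Y : MultiplierAlgebra k A} (h₁ : ∀ a, X.left a = Y.left a)
    (h₂ : ∀ a, X.right a = Y.right a) : X = Y :=
  Subtype.ext (Prod.ext (LinearMap.ext h₁) (LinearMap.ext h₂))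

/-- The product `(X, X')(Z, Z') = (X ∘ Z, Z' ∘ X')` of multipliers. -/
instance : Mul (MultiplierAlgebra k A) where
  mul X Z := ⟨(X.left ∘ₗ Z.left, Z.right ∘ₗ X.right), by
    intro a b
    simp only [LinearMap.comp_apply]
    rw [X.compat, Z.compat]⟩

instance : One (MultiplierAlgebra k A) where
  one := ⟨(LinearMap.id, LinearMap.id), by intro a b; rfl⟩

variable (k A) in
/-- The canonical map `A → M(A)`, sending `a` to (left multiplication, right multiplication). -/
def of : A →ₗ[k] MultiplierAlgebra k A where
  toFun a := ⟨(LinearMap.mulLeft k a, LinearMap.mulRight k a), by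
    intro x y
    simp [mul_assoc]⟩
  map_add' a b := by
    apply ext
    · exact fun x => add_mul a b x
    · exact fun x => mul_add x a b
  map_smul' c a := by
    apply ext
    · exact fun x => smul_mul_assoc c a x
    · exact fun x => mul_smul_comm c x a

/-- `X ⊗ Z ∈ M(A ⊗ B)` for `X ∈ M(A)` and `Z ∈ M(B)`. -/
def tmul (X : MultiplierAlgebra k A) (Z : MultiplierAlgebra k B) :
    MultiplierAlgebra k (A ⊗[k] B) :=
  ⟨(TensorProduct.map X.left Z.left, TensorProduct.map X.right Z.right), by
    intro s t
    dsimp only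
    induction s with
    | zero => simp
    | add s₁ s₂ h₁ h₂ => simp only [add_mul, map_add, h₁, h₂]
    | tmul a b =>
      induction t with
      | zero => simp
      | add t₁ t₂ h₁ h₂ => simp only [mul_add, map_add, h₁, h₂]
      | tmul c d =>
        simp only [TensorProduct.map_tmul, Algebra.TensorProduct.tmul_mul_tmul, compat]⟩

@[simp] theorem left_mul (X Z : MultiplierAlgebra k A) (a : A) :
    (X * Z).left a = X.left (Z.left a) := rfl

@[simp] theorem right_mul (X Z : MultiplierAlgebra k A) (a : A) :
    (X * Z).right a = Z.right (X.right a) := rfl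

@[simp] theorem left_one (a : A) : (1 : MultiplierAlgebra k A).left a = a := rfl

@[simp] theorem right_one (a : A) : (1 : MultiplierAlgebra k A).right a = a := rfl

@[simp] theorem left_of (a b : A) : (of k A a).left b = a * b := rfl

@[simp] theorem right_of (a b : A) : (of k A a).right b = b * a := rfl

@[simp] theorem left_tmul (X : MultiplierAlgebra k A) (Z : MultiplierAlgebra k B) (a : A) (b : B) :
    (tmul X Z).left (a ⊗ₜ b) = X.left a ⊗ₜ Z.left b := rfl

@[simp] theorem right_tmul (X : MultiplierAlgebra k A) (Z : MultiplierAlgebra k B) (a : A) (b : B) :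
    (tmul X Z).right (a ⊗ₜ b) = X.right a ⊗ₜ Z.right b := rfl

variable (B) in
/-- `a ⊗ 1 ∈ M(A ⊗ B)`. -/
def inl (a : A) : MultiplierAlgebra k (A ⊗[k] B) := tmul (of k A a) 1

variable (A) in
/-- `1 ⊗ b ∈ M(A ⊗ B)`. -/
def inr (b : B) : MultiplierAlgebra k (A ⊗[k] B) := tmul 1 (of k B b)

end MultiplierAlgebra

end Multipliers

/-! ### Multiplier Hopf algebras -/

/-- A multiplier Hopf algebra structure on a nondegenerate algebra `A` over the field `k`.
Since `A ⊗ A → M(A ⊗ A)` is injective, the maps `T₁, …, T₄` are determined by `comul`: their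
presence says that the four products `Δ(a)(1 ⊗ b)`, `(a ⊗ 1)Δ(b)`, `Δ(a)(b ⊗ 1)`, `(1 ⊗ a)Δ(b)`
lie in `A ⊗ A`. The counit is determined by either of its two laws. -/
structure MultiplierHopfAlgebra (k : Type*) [Field k] (A : Type*) [NonUnitalRing A] [Module k A]
    [SMulCommClass k A A] [IsScalarTower k A A] where
  eq_zero_of_mul_right : ∀ a : A, (∀ b : A, a * b = 0) → a = 0
  eq_zero_of_mul_left : ∀ b : A, (∀ a : A, a * b = 0) → b = 0
  comul : A →ₗ[k] MultiplierAlgebra k (A ⊗[k] A)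
  comul_mul : ∀ a b : A, comul (a * b) = comul a * comul b
  /-- `Δ(A)(A ⊗ A) = A ⊗ A` -/
  span_comul_left :
    Submodule.span k {z | ∃ (a : A) (t : A ⊗[k] A), z = (comul a).left t} = ⊤
  /-- `(A ⊗ A)Δ(A) = A ⊗ A` -/
  span_comul_right :
    Submodule.span k {z | ∃ (a : A) (t : A ⊗[k] A), z = (comul a).right t} = ⊤
  /-- `a ⊗ b ↦ Δ(a)(1 ⊗ b)` -/
  T₁ : A ⊗[k] A →ₗ[k] A ⊗[k] A
  T₁_spec : ∀ a b : A, MultiplierAlgebra.of k (A ⊗[k] A) (T₁ (a ⊗ₜ b))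
    = comul a * MultiplierAlgebra.inr A b
  /-- `a ⊗ b ↦ (a ⊗ 1)Δ(b)` -/
  T₂ : A ⊗[k] A →ₗ[k] A ⊗[k] A
  T₂_spec : ∀ a b : A, MultiplierAlgebra.of k (A ⊗[k] A) (T₂ (a ⊗ₜ b))
    = MultiplierAlgebra.inl A a * comul b
  /-- `a ⊗ b ↦ Δ(a)(b ⊗ 1)` -/
  T₃ : A ⊗[k] A →ₗ[k] A ⊗[k] A
  T₃_spec : ∀ a b : A, MultiplierAlgebra.of k (A ⊗[k] A) (T₃ (a ⊗ₜ b))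
    = comul a * MultiplierAlgebra.inl A b
  /-- `a ⊗ b ↦ (1 ⊗ a)Δ(b)` -/
  T₄ : A ⊗[k] A →ₗ[k] A ⊗[k] A
  T₄_spec : ∀ a b : A, MultiplierAlgebra.of k (A ⊗[k] A) (T₄ (a ⊗ₜ b))
    = MultiplierAlgebra.inr A a * comul b
  /-- Coassociativity `(Δ ⊗ ι)Δ = (ι ⊗ Δ)Δ`, multiplied by `a ⊗ 1 ⊗ 1` on the left and by
  `1 ⊗ 1 ⊗ c` on the right: `(T₂ ⊗ ι)(ι ⊗ T₁) = (ι ⊗ T₁)(T₂ ⊗ ι)`. -/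
  coassoc : ∀ a b c : A,
    TensorProduct.assoc k A A A (T₂.rTensor A ((TensorProduct.assoc k A A A).symm
        (a ⊗ₜ[k] T₁ (b ⊗ₜ[k] c))))
      = T₁.lTensor A (TensorProduct.assoc k A A A (T₂ (a ⊗ₜ[k] b) ⊗ₜ[k] c))
  bijective_T₁ : Function.Bijective T₁
  bijective_T₂ : Function.Bijective T₂
  counit : A →ₗ[k] k
  /-- `(ε ⊗ ι)(Δ(a)(1 ⊗ b)) = a b` -/
  counit_left : ∀ a b : A, TensorProduct.lid k A (counit.rTensor A (T₁ (a ⊗ₜ b))) = a * b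
  /-- `(ι ⊗ ε)((a ⊗ 1)Δ(b)) = a b` -/
  counit_right : ∀ a b : A, TensorProduct.rid k A (counit.lTensor A (T₂ (a ⊗ₜ b))) = a * b

/-! ### Every Hopf algebra is a multiplier Hopf algebra -/

section OfHopf

variable (k : Type*) [Field k] (A : Type*) [Ring A] [HopfAlgebra k A]

open Coalgebra in
/-- `a ⊗ b ↦ a₍₁₎ ⊗ f(a₍₂₎) b`. -/
def hopfF (f : A →ₗ[k] A) : A ⊗[k] A →ₗ[k] A ⊗[k] A :=
  LinearMap.lTensor A (LinearMap.mul' k A ∘ₗ f.rTensor A) ∘ₗ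
    (TensorProduct.assoc k A A A).toLinearMap ∘ₗ (comul (R := k) (A := A)).rTensor A

open Coalgebra in
/-- `a ⊗ b ↦ a f(b₍₁₎) ⊗ b₍₂₎`. -/
def hopfG (f : A →ₗ[k] A) : A ⊗[k] A →ₗ[k] A ⊗[k] A :=
  LinearMap.rTensor A (LinearMap.mul' k A ∘ₗ f.lTensor A) ∘ₗ
    (TensorProduct.assoc k A A A).symm.toLinearMap ∘ₗ (comul (R := k) (A := A)).lTensor A

variable {A}

open Coalgebra in
theorem hopfF_tmul (f : A →ₗ[k] A) (a b : A) :
    hopfF k A f (a ⊗ₜ b) = f.lTensor A (comul (R := k) a) * ((1 : A) ⊗ₜ[k] b) := by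
  simp only [hopfF, LinearMap.comp_apply, LinearMap.rTensor_tmul, LinearEquiv.coe_coe]
  induction comul (R := k) a with
  | zero => simp
  | add s t hs ht => simp only [TensorProduct.add_tmul, map_add, add_mul, hs, ht]
  | tmul x y => simp

open Coalgebra in
theorem hopfG_tmul (f : A →ₗ[k] A) (a b : A) :
    hopfG k A f (a ⊗ₜ b) = (a ⊗ₜ[k] (1 : A)) * f.rTensor A (comul (R := k) b) := by
  simp only [hopfG, LinearMap.comp_apply, LinearMap.lTensor_tmul, LinearEquiv.coe_coe]
  induction comul (R := k) b with
  | zero => simp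
  | add s t hs ht => simp only [TensorProduct.tmul_add, map_add, mul_add, hs, ht]
  | tmul x y => simp

open Coalgebra in
theorem hopfF_comp (f g : A →ₗ[k] A) :
    hopfF k A f ∘ₗ hopfF k A g
      = hopfF k A (LinearMap.mul' k A ∘ₗ TensorProduct.map f g ∘ₗ comul) := by
  ext a b
  let H : A ⊗[k] (A ⊗[k] A) →ₗ[k] A ⊗[k] A :=
    LinearMap.mulRight k ((1 : A) ⊗ₜ[k] b) ∘ₗ
      LinearMap.lTensor A (LinearMap.mul' k A ∘ₗ TensorProduct.map f g)
  have h₁ : ∀ t : A ⊗[k] A, hopfF k A f (g.lTensor A t * ((1 : A) ⊗ₜ[k] b))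
      = H (TensorProduct.assoc k A A A (comul.rTensor A t)) := by
    intro t
    induction t with
    | zero => simp
    | add s t hs ht => simp only [map_add, add_mul, hs, ht]
    | tmul x y =>
      simp only [LinearMap.lTensor_tmul, Algebra.TensorProduct.tmul_mul_tmul, mul_one,
        hopfF_tmul, LinearMap.rTensor_tmul]
      induction comul (R := k) x with
      | zero => simp
      | add s t hs ht => simp only [TensorProduct.add_tmul, map_add, add_mul, hs, ht]
      | tmul u v => simp [H, mul_assoc]
  have h₂ : ∀ t : A ⊗[k] A,
      (LinearMap.mul' k A ∘ₗ TensorProduct.map f g ∘ₗ comul).lTensor A t * ((1 : A) ⊗ₜ[k] b)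
        = H (comul.lTensor A t) := by
    intro t
    induction t with
    | zero => simp
    | add s t hs ht => simp only [map_add, add_mul, hs, ht]
    | tmul x y => simp [H]
  simp only [TensorProduct.AlgebraTensorModule.curry_apply, LinearMap.restrictScalars_self,
    TensorProduct.curry_apply, LinearMap.comp_apply]
  rw [hopfF_tmul, h₁, Coalgebra.coassoc_apply, ← h₂, hopfF_tmul]

open Coalgebra in
theorem hopfG_comp (f g : A →ₗ[k] A) :
    hopfG k A g ∘ₗ hopfG k A f
      = hopfG k A (LinearMap.mul' k A ∘ₗ TensorProduct.map f g ∘ₗ comul) := by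
  ext a b
  let H : (A ⊗[k] A) ⊗[k] A →ₗ[k] A ⊗[k] A :=
    LinearMap.mulLeft k (a ⊗ₜ[k] (1 : A)) ∘ₗ
      LinearMap.rTensor A (LinearMap.mul' k A ∘ₗ TensorProduct.map f g)
  have h₁ : ∀ t : A ⊗[k] A, hopfG k A g ((a ⊗ₜ[k] (1 : A)) * f.rTensor A t)
      = H ((TensorProduct.assoc k A A A).symm (comul.lTensor A t)) := by
    intro t
    induction t with
    | zero => simp
    | add s t hs ht => simp only [map_add, mul_add, hs, ht]
    | tmul x y =>
      simp only [LinearMap.rTensor_tmul, Algebra.TensorProduct.tmul_mul_tmul, one_mul,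
        hopfG_tmul, LinearMap.lTensor_tmul]
      induction comul (R := k) y with
      | zero => simp
      | add s t hs ht => simp only [TensorProduct.tmul_add, map_add, mul_add, hs, ht]
      | tmul u v => simp [H, mul_assoc]
  have h₂ : ∀ t : A ⊗[k] A,
      (a ⊗ₜ[k] (1 : A)) * (LinearMap.mul' k A ∘ₗ TensorProduct.map f g ∘ₗ comul).rTensor A t
        = H (comul.rTensor A t) := by
    intro t
    induction t with
    | zero => simp
    | add s t hs ht => simp only [map_add, mul_add, hs, ht]
    | tmul x y => simp [H]
  simp only [TensorProduct.AlgebraTensorModule.curry_apply, LinearMap.restrictScalars_self,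
    TensorProduct.curry_apply, LinearMap.comp_apply]
  rw [hopfG_tmul, h₁, Coalgebra.coassoc_symm_apply, ← h₂, hopfG_tmul]

open Coalgebra in
theorem hopfF_unit : hopfF k A (Algebra.linearMap k A ∘ₗ counit) = LinearMap.id := by
  ext a b
  simp only [TensorProduct.AlgebraTensorModule.curry_apply, LinearMap.restrictScalars_self,
    TensorProduct.curry_apply, hopfF_tmul, LinearMap.lTensor_comp_apply,
    Coalgebra.lTensor_counit_comul]
  simp

open Coalgebra in
theorem hopfG_unit : hopfG k A (Algebra.linearMap k A ∘ₗ counit) = LinearMap.id := by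
  ext a b
  simp only [TensorProduct.AlgebraTensorModule.curry_apply, LinearMap.restrictScalars_self,
    TensorProduct.curry_apply, hopfG_tmul, LinearMap.rTensor_comp_apply,
    Coalgebra.rTensor_counit_comul]
  simp

theorem bijective_of_comp_eq_id {V : Type*} [AddCommGroup V] [Module k V] {f g : V →ₗ[k] V}
    (h₁ : f ∘ₗ g = LinearMap.id) (h₂ : g ∘ₗ f = LinearMap.id) : Function.Bijective f :=
  Function.bijective_iff_has_inverse.2 ⟨g, LinearMap.congr_fun h₂, LinearMap.congr_fun h₁⟩

theorem hopf_id_antipode :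
    LinearMap.mul' k A ∘ₗ TensorProduct.map LinearMap.id (HopfAlgebra.antipode k) ∘ₗ
      Coalgebra.comul = Algebra.linearMap k A ∘ₗ Coalgebra.counit :=
  HopfAlgebra.mul_antipode_lTensor_comul

theorem hopf_antipode_id :
    LinearMap.mul' k A ∘ₗ TensorProduct.map (HopfAlgebra.antipode k) LinearMap.id ∘ₗ
      Coalgebra.comul = Algebra.linearMap k A ∘ₗ Coalgebra.counit :=
  HopfAlgebra.mul_antipode_rTensor_comul

theorem bijective_hopfF_id : Function.Bijective (hopfF k A LinearMap.id) :=
  bijective_of_comp_eq_id k (g := hopfF k A (HopfAlgebra.antipode k))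
    (by rw [hopfF_comp, hopf_id_antipode, hopfF_unit])
    (by rw [hopfF_comp, hopf_antipode_id, hopfF_unit])

theorem bijective_hopfG_id : Function.Bijective (hopfG k A LinearMap.id) :=
  bijective_of_comp_eq_id k (g := hopfG k A (HopfAlgebra.antipode k))
    (by rw [hopfG_comp, hopf_antipode_id, hopfG_unit])
    (by rw [hopfG_comp, hopf_id_antipode, hopfG_unit])

theorem hopfF_id_tmul (a b : A) :
    hopfF k A LinearMap.id (a ⊗ₜ b) = Coalgebra.comul (R := k) a * ((1 : A) ⊗ₜ[k] b) := by
  rw [hopfF_tmul, LinearMap.lTensor_id, LinearMap.id_apply]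

theorem hopfG_id_tmul (a b : A) :
    hopfG k A LinearMap.id (a ⊗ₜ b) = (a ⊗ₜ[k] (1 : A)) * Coalgebra.comul (R := k) b := by
  rw [hopfG_tmul, LinearMap.rTensor_id, LinearMap.id_apply]

namespace MultiplierAlgebra

variable {k}

theorem of_mul (a b : A) : of k A (a * b) = of k A a * of k A b :=
  ext (fun x => mul_assoc a b x) (fun x => (mul_assoc x a b).symm)

theorem inl_eq_of {B : Type*} [Ring B] [Algebra k B] (a : A) :
    inl B a = of k (A ⊗[k] B) (a ⊗ₜ 1) := by
  apply ext <;> intro t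
  · induction t with
    | zero => simp
    | add s t hs ht => simp only [map_add, hs, ht]
    | tmul x y => simp [inl]
  · induction t with
    | zero => simp
    | add s t hs ht => simp only [map_add, hs, ht]
    | tmul x y => simp [inl]

theorem inr_eq_of {B : Type*} [Ring B] [Algebra k B] (b : B) :
    inr A b = of k (A ⊗[k] B) (1 ⊗ₜ b) := by
  apply ext <;> intro t
  · induction t with
    | zero => simp
    | add s t hs ht => simp only [map_add, hs, ht]
    | tmul x y => simp [inr]
  · induction t with
    | zero => simp
    | add s t hs ht => simp only [map_add, hs, ht]
    | tmul x y => simp [inr]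

end MultiplierAlgebra

open Coalgebra in
variable (A) in
/-- A Hopf algebra `A` as a multiplier Hopf algebra: its comultiplication is followed by
`A ⊗ A → M(A ⊗ A)`. -/
def hopfMultiplierHopfAlgebra : MultiplierHopfAlgebra k A where
  eq_zero_of_mul_right a h := by simpa using h 1
  eq_zero_of_mul_left b h := by simpa using h 1
  comul := MultiplierAlgebra.of k (A ⊗[k] A) ∘ₗ comul
  comul_mul a b := by simp [Bialgebra.comul_mul, MultiplierAlgebra.of_mul]
  span_comul_left := by
    refine eq_top_iff.2 fun t _ => Submodule.subset_span ⟨1, t, ?_⟩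
    simp [Bialgebra.comul_one]
  span_comul_right := by
    refine eq_top_iff.2 fun t _ => Submodule.subset_span ⟨1, t, ?_⟩
    simp [Bialgebra.comul_one]
  T₁ := hopfF k A LinearMap.id
  T₁_spec a b := by
    rw [hopfF_id_tmul, MultiplierAlgebra.of_mul, MultiplierAlgebra.inr_eq_of]; rfl
  T₂ := hopfG k A LinearMap.id
  T₂_spec a b := by
    rw [hopfG_id_tmul, MultiplierAlgebra.of_mul, MultiplierAlgebra.inl_eq_of]; rfl
  T₃ := TensorProduct.lift ((LinearMap.mul k (A ⊗[k] A)).compl₁₂ comul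
    ((TensorProduct.mk k A A).flip 1))
  T₃_spec a b := by
    simp [MultiplierAlgebra.of_mul, MultiplierAlgebra.inl_eq_of]
  T₄ := TensorProduct.lift ((LinearMap.mul k (A ⊗[k] A)).compl₁₂
    (TensorProduct.mk k A A 1) comul)
  T₄_spec a b := by
    simp [MultiplierAlgebra.of_mul, MultiplierAlgebra.inr_eq_of]
  coassoc a b c := by
    have key : ∀ t : (A ⊗[k] A) ⊗[k] A,
        TensorProduct.assoc k A A A (((a ⊗ₜ[k] (1 : A)) ⊗ₜ[k] (1 : A)) * t
          * (((1 : A) ⊗ₜ[k] (1 : A)) ⊗ₜ[k] c))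
        = (a ⊗ₜ[k] ((1 : A) ⊗ₜ[k] (1 : A))) * TensorProduct.assoc k A A A t
          * ((1 : A) ⊗ₜ[k] ((1 : A) ⊗ₜ[k] c)) := by
      intro t
      induction t with
      | zero => simp
      | add s t hs ht => simp only [map_add, mul_add, add_mul, hs, ht]
      | tmul s z =>
        induction s with
        | zero => simp
        | add s t hs ht => simp only [TensorProduct.add_tmul, map_add, mul_add, add_mul, hs, ht]
        | tmul x y => simp
    have h₁ : ∀ t : A ⊗[k] A, (hopfG k A LinearMap.id).rTensor A
        ((TensorProduct.assoc k A A A).symm (a ⊗ₜ[k] (t * ((1 : A) ⊗ₜ[k] c))))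
        = ((a ⊗ₜ[k] (1 : A)) ⊗ₜ[k] (1 : A)) * comul.rTensor A t
          * (((1 : A) ⊗ₜ[k] (1 : A)) ⊗ₜ[k] c) := by
      intro t
      induction t with
      | zero => simp
      | add s t hs ht => simp only [TensorProduct.tmul_add, map_add, mul_add, add_mul, hs, ht]
      | tmul x y =>
        simp [hopfG_id_tmul, ← Algebra.TensorProduct.one_def]
    have h₂ : ∀ t : A ⊗[k] A, (hopfF k A LinearMap.id).lTensor A
        (TensorProduct.assoc k A A A (((a ⊗ₜ[k] (1 : A)) * t) ⊗ₜ[k] c))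
        = (a ⊗ₜ[k] ((1 : A) ⊗ₜ[k] (1 : A))) * comul.lTensor A t
          * ((1 : A) ⊗ₜ[k] ((1 : A) ⊗ₜ[k] c)) := by
      intro t
      induction t with
      | zero => simp
      | add s t hs ht => simp only [TensorProduct.add_tmul, map_add, mul_add, add_mul, hs, ht]
      | tmul x y =>
        simp [hopfF_id_tmul, ← Algebra.TensorProduct.one_def]
    rw [hopfF_id_tmul, hopfG_id_tmul, h₁, h₂, key, Coalgebra.coassoc_apply]
  bijective_T₁ := bijective_hopfF_id k
  bijective_T₂ := bijective_hopfG_id k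
  counit := counit
  counit_left a b := by
    have h : ∀ t : A ⊗[k] A, TensorProduct.lid k A (counit.rTensor A (t * ((1 : A) ⊗ₜ[k] b)))
        = TensorProduct.lid k A (counit.rTensor A t) * b := by
      intro t
      induction t with
      | zero => simp
      | add s t hs ht => simp only [map_add, add_mul, hs, ht]
      | tmul x y => simp
    rw [hopfF_id_tmul, h, Coalgebra.rTensor_counit_comul]
    simp
  counit_right a b := by
    have h : ∀ t : A ⊗[k] A, TensorProduct.rid k A (counit.lTensor A ((a ⊗ₜ[k] (1 : A)) * t))
        = a * TensorProduct.rid k A (counit.lTensor A t) := by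
      intro t
      induction t with
      | zero => simp
      | add s t hs ht => simp only [map_add, mul_add, hs, ht]
      | tmul x y => simp
    rw [hopfG_id_tmul, h, Coalgebra.lTensor_counit_comul]
    simp

end OfHopf

/-! ### Partial comodule coalgebras over a Hopf algebra -/

section HopfCase

variable {k : Type*} [Field k] {A : Type*} [Ring A] [HopfAlgebra k A]
variable {Y : Type*} [AddCommGroup Y] [Module k Y] [Coalgebra k Y]

open Coalgebra

/-- `(ι ⊗ ε_Y) : A ⊗ Y → A`. -/
def idTensorCounit (k A : Type*) [Field k] [AddCommGroup A] [Module k A] {Y : Type*}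
    [AddCommGroup Y] [Module k Y] (ε : Y →ₗ[k] k) : A ⊗[k] Y →ₗ[k] A :=
  (TensorProduct.rid k A).toLinearMap ∘ₗ ε.lTensor A

/-- `(ε_A ⊗ ι) : A ⊗ Y → Y`. -/
def counitTensorId (k : Type*) [Field k] {A : Type*} (Y : Type*) [AddCommGroup A] [Module k A]
    [AddCommGroup Y] [Module k Y] (ε : A →ₗ[k] k) : A ⊗[k] Y →ₗ[k] Y :=
  (TensorProduct.lid k Y).toLinearMap ∘ₗ ε.rTensor Y

/-- `ρ : Y → A ⊗ Y` makes the coalgebra `Y` a (left) partial `A`-comodule coalgebra. -/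
structure IsPartialCoaction (ρ : Y →ₗ[k] A ⊗[k] Y) : Prop where
  /-- `(ε_A ⊗ ι)ρ = ι` -/
  counit : counitTensorId k Y (counit (R := k) (A := A)) ∘ₗ ρ = LinearMap.id
  /-- `(ι ⊗ Δ_Y)ρ = (m_A ⊗ ι ⊗ ι)(ι ⊗ τ_{Y,A} ⊗ ι)(ρ ⊗ ρ)Δ_Y` -/
  comul : (comul (R := k) (A := Y)).lTensor A ∘ₗ ρ
    = (LinearMap.mul' k A).rTensor (Y ⊗[k] Y)
        ∘ₗ (TensorProduct.tensorTensorTensorComm k A Y A Y).toLinearMap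
        ∘ₗ TensorProduct.map ρ ρ ∘ₗ comul (R := k) (A := Y)
  /-- `(ι ⊗ ρ)ρ = (m_A ⊗ ι ⊗ ι){(ι ⊗ ε_Y)ρ ⊗ (Δ_A ⊗ ι)ρ}Δ_Y` -/
  coassoc : ρ.lTensor A ∘ₗ ρ
    = (LinearMap.mul' k A).rTensor (A ⊗[k] Y)
        ∘ₗ (TensorProduct.assoc k A A (A ⊗[k] Y)).symm.toLinearMap
        ∘ₗ TensorProduct.map (idTensorCounit k A (Coalgebra.counit (R := k) (A := Y)) ∘ₗ ρ)
            ((TensorProduct.assoc k A A Y).toLinearMap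
              ∘ₗ (Coalgebra.comul (R := k) (A := A)).rTensor Y ∘ₗ ρ)
        ∘ₗ Coalgebra.comul (R := k) (A := Y)

/-- `ρ : Y → A ⊗ Y` makes the coalgebra `Y` a symmetric (left) partial `A`-comodule coalgebra. -/
structure IsSymmPartialCoaction (ρ : Y →ₗ[k] A ⊗[k] Y) : Prop extends IsPartialCoaction ρ where
  /-- `(ι ⊗ ρ)ρ = (m_A ⊗ ι ⊗ ι)(ι ⊗ τ_{A ⊗ Y, A}){(Δ_A ⊗ ι)ρ ⊗ (ι ⊗ ε_Y)ρ}Δ_Y` -/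
  coassoc_symm : ρ.lTensor A ∘ₗ ρ
    = (LinearMap.mul' k A).rTensor (A ⊗[k] Y)
        ∘ₗ (TensorProduct.assoc k A A (A ⊗[k] Y)).symm.toLinearMap
        ∘ₗ (TensorProduct.comm k (A ⊗[k] Y) A).toLinearMap.lTensor A
        ∘ₗ (TensorProduct.assoc k A (A ⊗[k] Y) A).toLinearMap
        ∘ₗ TensorProduct.map
            ((TensorProduct.assoc k A A Y).toLinearMap
              ∘ₗ (Coalgebra.comul (R := k) (A := A)).rTensor Y ∘ₗ ρ)
            (idTensorCounit k A (Coalgebra.counit (R := k) (A := Y)) ∘ₗ ρ)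
        ∘ₗ Coalgebra.comul (R := k) (A := Y)

variable (k A Y) in
/-- The coalgebra `Y` is a partial comodule coalgebra over the Hopf algebra `A`. -/
def IsPartialComoduleCoalgebra : Prop :=
  ∃ ρ : Y →ₗ[k] A ⊗[k] Y, IsPartialCoaction ρ

variable (k A Y) in
/-- The coalgebra `Y` is a symmetric partial comodule coalgebra over the Hopf algebra `A`. -/
def IsSymmPartialComoduleCoalgebra : Prop :=
  ∃ ρ : Y →ₗ[k] A ⊗[k] Y, IsSymmPartialCoaction ρ

end HopfCase

/-! ### Partial comodule coalgebras over a multiplier Hopf algebra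

An expression with values in multipliers is always read after multiplication by algebra elements
in enough tensor factors; multipliers are determined by these products. -/

namespace MultiplierHopfAlgebra

variable {k : Type*} [Field k]
variable {A : Type*} [NonUnitalRing A] [Module k A] [SMulCommClass k A A] [IsScalarTower k A A]
variable {Y : Type*} [NonUnitalRing Y] [Module k Y] [SMulCommClass k Y Y] [IsScalarTower k Y Y]
variable (HA : MultiplierHopfAlgebra k A) (HY : MultiplierHopfAlgebra k Y)

/-- `b ↦ Δ(b)(1 ⊗ c)`. -/
def comulMul (c : A) : A →ₗ[k] A ⊗[k] A := HA.T₁ ∘ₗ (TensorProduct.mk k A A).flip c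

/-- `b ↦ (1 ⊗ c)Δ(b)`. -/
def mulComul (c : A) : A →ₗ[k] A ⊗[k] A := HA.T₄ ∘ₗ TensorProduct.mk k A A c

/-- `m ∈ M(Y)` is the value at `X ∈ M(A ⊗ Y)` of the unique extension of `φ : A ⊗ Y → Y` to
multipliers: `m φ(z) = φ(X z)` and `φ(z) m = φ(z X)` for all `z`. -/
def IsExtensionValue (φ : A ⊗[k] Y →ₗ[k] Y) (X : MultiplierAlgebra k (A ⊗[k] Y))
    (m : MultiplierAlgebra k Y) : Prop :=
  ∀ z : A ⊗[k] Y, m.left (φ z) = φ (X.left z) ∧ m.right (φ z) = φ (X.right z)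

/-- `(ι_Y ⊗ T)(Δ_Y(y)(v ⊗ 1) ⊗ a)`, that is `((ι_Y ⊗ T)(Δ_Y(y) ⊗ a))(v ⊗ 1 ⊗ 1)`. -/
def idTensorCover (T : Y ⊗[k] A →ₗ[k] A ⊗[k] Y) (y : Y) (a : A) (v : Y) :
    Y ⊗[k] (A ⊗[k] Y) :=
  T.lTensor Y (TensorProduct.assoc k Y Y A (HY.T₃ (y ⊗ₜ[k] v) ⊗ₜ[k] a))

/-- `(ι_Y ⊗ T)((v ⊗ 1)Δ_Y(y) ⊗ a)`, that is `(v ⊗ 1 ⊗ 1)((ι_Y ⊗ T)(Δ_Y(y) ⊗ a))`. -/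
def coverIdTensor (T : Y ⊗[k] A →ₗ[k] A ⊗[k] Y) (y : Y) (a : A) (v : Y) :
    Y ⊗[k] (A ⊗[k] Y) :=
  T.lTensor Y (TensorProduct.assoc k Y Y A (HY.T₂ (v ⊗ₜ[k] y) ⊗ₜ[k] a))

/-- The element `w ∈ Y ⊗ A ⊗ Y` equals `((ι_Y ⊗ T)(Δ_Y(y) ⊗ a))(1 ⊗ 1 ⊗ y')`. -/
def IsRightCover (T : Y ⊗[k] A →ₗ[k] A ⊗[k] Y) (y : Y) (a : A) (y' : Y)
    (w : Y ⊗[k] (A ⊗[k] Y)) : Prop :=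
  ∀ v : Y,
    (LinearMap.mulRight k v).rTensor (A ⊗[k] Y) w
        = ((LinearMap.mulRight k y').lTensor A).lTensor Y (HY.idTensorCover T y a v) ∧
    (LinearMap.mulLeft k v).rTensor (A ⊗[k] Y) w
        = ((LinearMap.mulRight k y').lTensor A).lTensor Y (HY.coverIdTensor T y a v)

/-- The element `w ∈ Y ⊗ A ⊗ Y` equals `(1 ⊗ 1 ⊗ y')((ι_Y ⊗ T)(Δ_Y(y) ⊗ a))`. -/
def IsLeftCover (T : Y ⊗[k] A →ₗ[k] A ⊗[k] Y) (y : Y) (a : A) (y' : Y)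
    (w : Y ⊗[k] (A ⊗[k] Y)) : Prop :=
  ∀ v : Y,
    (LinearMap.mulRight k v).rTensor (A ⊗[k] Y) w
        = ((LinearMap.mulLeft k y').lTensor A).lTensor Y (HY.idTensorCover T y a v) ∧
    (LinearMap.mulLeft k v).rTensor (A ⊗[k] Y) w
        = ((LinearMap.mulLeft k y').lTensor A).lTensor Y (HY.coverIdTensor T y a v)

/-- `ρ : Y → M(A ⊗ Y)` makes `Y` a (left) partial `A`-comodule coalgebra, where
`T(y ⊗ a) = ρ(y)(a ⊗ 1)` is required to lie in `A ⊗ Y`. -/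
structure IsPartialCoactionVia (ρ : Y →ₗ[k] MultiplierAlgebra k (A ⊗[k] Y))
    (T : Y ⊗[k] A →ₗ[k] A ⊗[k] Y) : Prop where
  /-- `T(y ⊗ a) = ρ(y)(a ⊗ 1)` -/
  spec : ∀ (y : Y) (a : A), MultiplierAlgebra.of k (A ⊗[k] Y) (T (y ⊗ₜ a))
    = ρ y * MultiplierAlgebra.inl Y a
  /-- `(ε_A ⊗ ι)ρ(y) = y` -/
  counit : ∀ y : Y,
    IsExtensionValue (counitTensorId k Y HA.counit) (ρ y) (MultiplierAlgebra.of k Y y)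
  /-- `((ι ⊗ T)(Δ_Y(y) ⊗ a))(1 ⊗ 1 ⊗ y') ∈ Y ⊗ A ⊗ Y` -/
  right_mem : ∀ (y y' : Y) (a : A), ∃ w, HY.IsRightCover T y a y' w
  /-- `(1 ⊗ 1 ⊗ y')((ι ⊗ T)(Δ_Y(y) ⊗ a)) ∈ Y ⊗ A ⊗ Y` -/
  left_mem : ∀ (y y' : Y) (a : A), ∃ w, HY.IsLeftCover T y a y' w
  /-- `(ι ⊗ Δ_Y)T = (T ⊗ ι)(ι ⊗ T)(Δ_Y ⊗ ι)`, multiplied by `1 ⊗ 1 ⊗ y'` on the right -/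
  comul_right : ∀ (y y' : Y) (a : A) (w : Y ⊗[k] (A ⊗[k] Y)), HY.IsRightCover T y a y' w →
    (HY.comulMul y').lTensor A (T (y ⊗ₜ[k] a))
      = TensorProduct.assoc k A Y Y (T.rTensor Y ((TensorProduct.assoc k Y A Y).symm w))
  /-- `(ι ⊗ Δ_Y)T = (T ⊗ ι)(ι ⊗ T)(Δ_Y ⊗ ι)`, multiplied by `1 ⊗ 1 ⊗ y'` on the left -/
  comul_left : ∀ (y y' : Y) (a : A) (w : Y ⊗[k] (A ⊗[k] Y)), HY.IsLeftCover T y a y' w →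
    (HY.mulComul y').lTensor A (T (y ⊗ₜ[k] a))
      = TensorProduct.assoc k A Y Y (T.rTensor Y ((TensorProduct.assoc k Y A Y).symm w))
  /-- `(ι ⊗ T)(T ⊗ ι)(ι ⊗ Δ_A) = ((ι ⊗ ε_Y)T ⊗ ι ⊗ ι)(ι ⊗ (Δ_A ⊗ ι)T)(Δ_Y ⊗ ι)`, multiplied by
  `1 ⊗ a' ⊗ y'` on the right -/
  coassoc : ∀ (y y' : Y) (a a' : A) (w : Y ⊗[k] (A ⊗[k] Y)), HY.IsRightCover T y a y' w →
    ((LinearMap.mulRight k y').lTensor A).lTensor A (T.lTensor A (TensorProduct.assoc k A Y A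
        (T.rTensor A ((TensorProduct.assoc k Y A A).symm (y ⊗ₜ[k] HA.comulMul a' a)))))
      = (idTensorCounit k A HY.counit ∘ₗ T).rTensor (A ⊗[k] Y)
          ((TensorProduct.assoc k Y A (A ⊗[k] Y)).symm
            ((TensorProduct.assoc k A A Y).toLinearMap.lTensor Y
              (((HA.comulMul a').rTensor Y).lTensor Y w)))

/-- The element `w ∈ A ⊗ Y ⊗ Y` equals `((T' ⊗ ι_Y)(a ⊗ Δ_Y(y)))(1 ⊗ y' ⊗ 1)`. -/
def IsMiddleCover (T' : A ⊗[k] Y →ₗ[k] A ⊗[k] Y) (a : A) (y y' : Y)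
    (w : A ⊗[k] (Y ⊗[k] Y)) : Prop :=
  ∀ v : Y,
    ((LinearMap.mulRight k v).lTensor Y).lTensor A w
        = ((LinearMap.mulRight k y').rTensor Y).lTensor A (TensorProduct.assoc k A Y Y
            (T'.rTensor Y ((TensorProduct.assoc k A Y Y).symm (a ⊗ₜ[k] HY.comulMul v y)))) ∧
    ((LinearMap.mulLeft k v).lTensor Y).lTensor A w
        = ((LinearMap.mulRight k y').rTensor Y).lTensor A (TensorProduct.assoc k A Y Y
            (T'.rTensor Y ((TensorProduct.assoc k A Y Y).symm (a ⊗ₜ[k] HY.mulComul v y))))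

/-- The additional conditions on a symmetric partial `A`-comodule coalgebra, where
`T'(a ⊗ y) = (a ⊗ 1)ρ(y)` is required to lie in `A ⊗ Y`. -/
structure IsSymmetricVia (ρ : Y →ₗ[k] MultiplierAlgebra k (A ⊗[k] Y))
    (T' : A ⊗[k] Y →ₗ[k] A ⊗[k] Y) : Prop where
  /-- `T'(a ⊗ y) = (a ⊗ 1)ρ(y)` -/
  spec : ∀ (a : A) (y : Y), MultiplierAlgebra.of k (A ⊗[k] Y) (T' (a ⊗ₜ y))
    = MultiplierAlgebra.inl Y a * ρ y
  /-- `(T' ⊗ ι)(a ⊗ Δ_Y(y))(1 ⊗ y' ⊗ 1) ∈ A ⊗ Y ⊗ Y` -/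
  middle_mem : ∀ (a : A) (y y' : Y), ∃ w, HY.IsMiddleCover T' a y y' w
  /-- `(ι ⊗ T')(ι ⊗ τ)(T' ⊗ ι)(ι ⊗ τ)(Δ_A ⊗ ι)
    = ((ι ⊗ ε_Y)T' ⊗ ι ⊗ ι)(ι ⊗ τ_{A ⊗ Y, Y})((Δ_A ⊗ ι)T' ⊗ ι)(ι ⊗ Δ_Y)`, multiplied by
  `1 ⊗ a' ⊗ 1` on the left and by `1 ⊗ 1 ⊗ y'` on the right -/
  coassoc : ∀ (a a' : A) (y y' : Y) (w : A ⊗[k] (Y ⊗[k] Y)), HY.IsMiddleCover T' a y y' w →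
    ((LinearMap.mulRight k y').lTensor A).lTensor A
        (T'.lTensor A ((TensorProduct.comm k Y A).toLinearMap.lTensor A
          (TensorProduct.assoc k A Y A (T'.rTensor A ((TensorProduct.assoc k A Y A).symm
            ((TensorProduct.comm k A Y).toLinearMap.lTensor A
              (TensorProduct.assoc k A A Y (HA.mulComul a' a ⊗ₜ[k] y))))))))
      = (idTensorCounit k A HY.counit ∘ₗ T').rTensor (A ⊗[k] Y)
          ((TensorProduct.assoc k A Y (A ⊗[k] Y)).symm
            ((TensorProduct.comm k (A ⊗[k] Y) Y).toLinearMap.lTensor A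
              (TensorProduct.assoc k A (A ⊗[k] Y) Y
                ((TensorProduct.assoc k A A Y).toLinearMap.rTensor Y
                  (((HA.mulComul a').rTensor Y).rTensor Y
                    ((TensorProduct.assoc k A Y Y).symm w))))))

/-- `ρ : Y → M(A ⊗ Y)` makes `Y` a (left) partial `A`-comodule coalgebra. -/
def IsPartialCoaction (ρ : Y →ₗ[k] MultiplierAlgebra k (A ⊗[k] Y)) : Prop :=
  ∃ T : Y ⊗[k] A →ₗ[k] A ⊗[k] Y, IsPartialCoactionVia HA HY ρ T

/-- `ρ : Y → M(A ⊗ Y)` makes `Y` a symmetric (left) partial `A`-comodule coalgebra. -/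
def IsSymmPartialCoaction (ρ : Y →ₗ[k] MultiplierAlgebra k (A ⊗[k] Y)) : Prop :=
  IsPartialCoaction HA HY ρ ∧ ∃ T' : A ⊗[k] Y →ₗ[k] A ⊗[k] Y, IsSymmetricVia HA HY ρ T'

/-- `Y` is a partial comodule coalgebra over the multiplier Hopf algebra `A`. -/
def IsPartialComoduleCoalgebra : Prop :=
  ∃ ρ : Y →ₗ[k] MultiplierAlgebra k (A ⊗[k] Y), IsPartialCoaction HA HY ρ

/-- `Y` is a symmetric partial comodule coalgebra over the multiplier Hopf algebra `A`. -/
def IsSymmPartialComoduleCoalgebra : Prop :=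
  ∃ ρ : Y →ₗ[k] MultiplierAlgebra k (A ⊗[k] Y), IsSymmPartialCoaction HA HY ρ

end MultiplierHopfAlgebra

end

/-! ### Multipliers of a unital algebra -/

namespace MultiplierAlgebra

variable {k : Type*} [Field k] {B : Type*} [Ring B] [Algebra k B]

/-! For a unital algebra `B` the canonical map `B → M(B)` is an isomorphism, with inverse `X ↦ X·1`.
Hence composing with it loses nothing: `ρ` and its multiplier-valued version determine each other,
and `T`, `T'` are forced to be `ρ(y)(a ⊗ 1)` and `(a ⊗ 1)ρ(y)`.

In the same way, a covered expression `w` is pinned down by its defining condition at `v = 1`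
(`hopf_isRightCover_iff`, `hopf_isLeftCover_iff`, `hopf_isMiddleCover_iff`). So (M2) and (M5) hold
automatically, and an axiom quantified over all covers `w` concerns one explicit element.

What remains is that each covered axiom is the corresponding Hopf axiom multiplied by a fixed
element. The right-covered (M3) is (H2) times `a ⊗ 1 ⊗ y'` (`rightCover_comul`); the left-covered
one is (H2) with `1 ⊗ 1 ⊗ y'` on the left and `a ⊗ 1 ⊗ 1` on the right (`leftCover_comul`). (M4) is
(H3) times `Δ(a)(1 ⊗ a') ⊗ y'` on the right (`coaction_twice_mulRight`, `rightCover_coassoc`). (M6)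
is (H4) with `(1 ⊗ a')Δ(a) ⊗ 1` on the left and `1 ⊗ 1 ⊗ y'` on the right (`coaction_twice_mulLeft`,
`middleCover_coassoc`). Multiplying gives (H) ⇒ (M); putting all covering elements equal to `1`
gives the converse, since `Δ(1) = 1 ⊗ 1`. -/

theorem of_injective : Function.Injective (of k B) := fun a b h => by
  simpa using congrArg (fun X => X.left 1) h

/-- Compatibility at `(1, 1)` gives `X1 = 1X`; compatibility with one argument equal to `1` then
shows that this element acts as `X` on both sides. A unital algebra therefore has no multipliers
besides its own elements. -/
theorem of_left_one (X : MultiplierAlgebra k B) : of k B (X.left 1) = X := by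
  have h : X.left 1 = X.right 1 := by simpa using X.compat 1 1
  apply ext <;> intro a
  · rw [left_of, h, ← X.compat, one_mul]
  · rw [right_of, X.compat, mul_one]

theorem bijective_of_comp {V : Type*} [AddCommGroup V] [Module k V] :
    Function.Bijective (fun ρ : V →ₗ[k] B => of k B ∘ₗ ρ) := by
  let e : B ≃ₗ[k] MultiplierAlgebra k B :=
    LinearEquiv.ofBijective (of k B) ⟨of_injective, fun X => ⟨_, of_left_one X⟩⟩
  refine ⟨fun ρ σ h => LinearMap.ext fun y => of_injective (LinearMap.congr_fun h y), fun σ => ?_⟩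
  exact ⟨e.symm.toLinearMap ∘ₗ σ, LinearMap.ext fun y => e.apply_symm_apply (σ y)⟩

end MultiplierAlgebra

/-! ### Structure maps and counit of the multiplier Hopf algebra of a Hopf algebra -/

section HopfMultiplier

variable {k : Type*} [Field k] {A : Type*} [Ring A] [HopfAlgebra k A]
  {Y : Type*} [Ring Y] [HopfAlgebra k Y]

open TensorProduct
open Coalgebra (comul counit)

theorem hopf_comulMul (c b : A) :
    (hopfMultiplierHopfAlgebra k A).comulMul c b = comul (R := k) b * ((1 : A) ⊗ₜ[k] c) :=
  hopfF_id_tmul k b c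

theorem hopf_mulComul (c b : A) :
    (hopfMultiplierHopfAlgebra k A).mulComul c b = ((1 : A) ⊗ₜ[k] c) * comul (R := k) b := by
  simp [MultiplierHopfAlgebra.mulComul, hopfMultiplierHopfAlgebra]

theorem hopf_T₃ (b c : A) :
    (hopfMultiplierHopfAlgebra k A).T₃ (b ⊗ₜ c) = comul (R := k) b * (c ⊗ₜ[k] (1 : A)) := by
  simp [hopfMultiplierHopfAlgebra]

theorem hopf_T₂ (b c : A) :
    (hopfMultiplierHopfAlgebra k A).T₂ (b ⊗ₜ c) = (b ⊗ₜ[k] (1 : A)) * comul (R := k) c :=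
  hopfG_id_tmul k b c

theorem hopf_counit : (hopfMultiplierHopfAlgebra k A).counit = counit (R := k) (A := A) := rfl

theorem counitTensorId_mul (s t : A ⊗[k] Y) :
    counitTensorId k Y (counit (R := k) (A := A)) (s * t)
      = counitTensorId k Y counit s * counitTensorId k Y counit t := by
  induction s with
  | zero => simp
  | add s₁ s₂ h₁ h₂ => simp only [add_mul, map_add, h₁, h₂]
  | tmul a y =>
    induction t with
    | zero => simp
    | add t₁ t₂ h₁ h₂ => simp only [mul_add, map_add, h₁, h₂]
    | tmul b z => simp [counitTensorId, smul_smul, mul_comm]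

theorem counitTensorId_one : counitTensorId k Y (counit (R := k) (A := A)) 1 = 1 := by
  simp [counitTensorId, Algebra.TensorProduct.one_def]

/-- Since `ε_A` is multiplicative, `ε_A ⊗ ι` is a unital algebra map, so its extension to
multipliers takes the expected value. Testing at `z = 1` recovers that value, which turns (M1) into
(H1). -/
theorem isExtensionValue_counitTensorId_of_iff (x : A ⊗[k] Y) (y : Y) :
    MultiplierHopfAlgebra.IsExtensionValue (counitTensorId k Y (counit (R := k) (A := A)))
        (MultiplierAlgebra.of k _ x) (MultiplierAlgebra.of k Y y)
      ↔ counitTensorId k Y counit x = y := by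
  constructor
  · intro h
    simpa [counitTensorId_one] using (h 1).1.symm
  · rintro rfl z
    simp [counitTensorId_mul]

/-! ### Covered expressions -/

/-- `(ι_Y ⊗ T)(Δ_Y(y) ⊗ a)`. -/
def idTensorComul (T : Y ⊗[k] A →ₗ[k] A ⊗[k] Y) (y : Y) (a : A) : Y ⊗[k] (A ⊗[k] Y) :=
  T.lTensor Y (TensorProduct.assoc k Y Y A (comul (R := k) y ⊗ₜ[k] a))

/-- The covering factor `v` acts on the first leg of `Δ(y)` and `T` only on the second, so the two
operations commute. -/
theorem hopf_idTensorCover (T : Y ⊗[k] A →ₗ[k] A ⊗[k] Y) (y : Y) (a : A) (v : Y) :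
    (hopfMultiplierHopfAlgebra k Y).idTensorCover T y a v
      = (LinearMap.mulRight k v).rTensor (A ⊗[k] Y) (idTensorComul T y a) := by
  rw [MultiplierHopfAlgebra.idTensorCover, idTensorComul, hopf_T₃]
  induction comul (R := k) y with
  | zero => simp
  | add s t hs ht => simp only [add_mul, add_tmul, map_add, hs, ht]
  | tmul x z => simp

theorem hopf_coverIdTensor (T : Y ⊗[k] A →ₗ[k] A ⊗[k] Y) (y : Y) (a : A) (v : Y) :
    (hopfMultiplierHopfAlgebra k Y).coverIdTensor T y a v
      = (LinearMap.mulLeft k v).rTensor (A ⊗[k] Y) (idTensorComul T y a) := by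
  rw [MultiplierHopfAlgebra.coverIdTensor, idTensorComul, hopf_T₂]
  induction comul (R := k) y with
  | zero => simp
  | add s t hs ht => simp only [mul_add, add_tmul, map_add, hs, ht]
  | tmul x z => simp

/-- At `v = 1` the covering condition reads off `w`. Conversely, `v` multiplies the first tensor
factor and `y'` the last, so the order of the two multiplications is immaterial. -/
theorem hopf_isRightCover_iff (T : Y ⊗[k] A →ₗ[k] A ⊗[k] Y) (y : Y) (a : A) (y' : Y)
    (w : Y ⊗[k] (A ⊗[k] Y)) :
    (hopfMultiplierHopfAlgebra k Y).IsRightCover T y a y' w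
      ↔ w = ((LinearMap.mulRight k y').lTensor A).lTensor Y (idTensorComul T y a) := by
  simp only [MultiplierHopfAlgebra.IsRightCover, hopf_idTensorCover, hopf_coverIdTensor]
  constructor
  · intro h
    simpa using (h 1).1
  · rintro rfl v
    simp only [← LinearMap.comp_apply, LinearMap.rTensor_comp_lTensor,
      LinearMap.lTensor_comp_rTensor, and_self]

theorem hopf_isLeftCover_iff (T : Y ⊗[k] A →ₗ[k] A ⊗[k] Y) (y : Y) (a : A) (y' : Y)
    (w : Y ⊗[k] (A ⊗[k] Y)) :
    (hopfMultiplierHopfAlgebra k Y).IsLeftCover T y a y' w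
      ↔ w = ((LinearMap.mulLeft k y').lTensor A).lTensor Y (idTensorComul T y a) := by
  simp only [MultiplierHopfAlgebra.IsLeftCover, hopf_idTensorCover, hopf_coverIdTensor]
  constructor
  · intro h
    simpa using (h 1).1
  · rintro rfl v
    simp only [← LinearMap.comp_apply, LinearMap.rTensor_comp_lTensor,
      LinearMap.lTensor_comp_rTensor, and_self]

/-- `(T' ⊗ ι_Y)(a ⊗ t)`. -/
def tensorIdApply (T' : A ⊗[k] Y →ₗ[k] A ⊗[k] Y) (a : A) (t : Y ⊗[k] Y) : A ⊗[k] (Y ⊗[k] Y) :=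
  TensorProduct.assoc k A Y Y (T'.rTensor Y ((TensorProduct.assoc k A Y Y).symm (a ⊗ₜ[k] t)))

/-- The factor `v` sits in the last leg, which `T' ⊗ ι` does not touch. -/
theorem tensorIdApply_mulRight (T' : A ⊗[k] Y →ₗ[k] A ⊗[k] Y) (a : A) (t : Y ⊗[k] Y) (v : Y) :
    tensorIdApply T' a (t * ((1 : Y) ⊗ₜ[k] v))
      = ((LinearMap.mulRight k v).lTensor Y).lTensor A (tensorIdApply T' a t) := by
  unfold tensorIdApply
  induction t with
  | zero => simp
  | add s t hs ht => simp only [add_mul, tmul_add, map_add, hs, ht]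
  | tmul x z =>
    simp only [Algebra.TensorProduct.tmul_mul_tmul, mul_one, assoc_symm_tmul,
      LinearMap.rTensor_tmul]
    induction T' (a ⊗ₜ x) with
    | zero => simp
    | add s t hs ht => simp only [add_tmul, map_add, hs, ht]
    | tmul b u => simp

theorem tensorIdApply_mulLeft (T' : A ⊗[k] Y →ₗ[k] A ⊗[k] Y) (a : A) (t : Y ⊗[k] Y) (v : Y) :
    tensorIdApply T' a (((1 : Y) ⊗ₜ[k] v) * t)
      = ((LinearMap.mulLeft k v).lTensor Y).lTensor A (tensorIdApply T' a t) := by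
  unfold tensorIdApply
  induction t with
  | zero => simp
  | add s t hs ht => simp only [mul_add, tmul_add, map_add, hs, ht]
  | tmul x z =>
    simp only [Algebra.TensorProduct.tmul_mul_tmul, one_mul, assoc_symm_tmul,
      LinearMap.rTensor_tmul]
    induction T' (a ⊗ₜ x) with
    | zero => simp
    | add s t hs ht => simp only [add_tmul, map_add, hs, ht]
    | tmul b u => simp

/-- Here `y'` acts on the middle factor and `v` on the last; again they commute, and `v = 1`
determines `w`. -/
theorem hopf_isMiddleCover_iff (T' : A ⊗[k] Y →ₗ[k] A ⊗[k] Y) (a : A) (y y' : Y)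
    (w : A ⊗[k] (Y ⊗[k] Y)) :
    (hopfMultiplierHopfAlgebra k Y).IsMiddleCover T' a y y' w
      ↔ w = ((LinearMap.mulRight k y').rTensor Y).lTensor A (tensorIdApply T' a (comul y)) := by
  have h₁ (v : Y) := tensorIdApply_mulRight T' a (comul (R := k) y) v
  have h₂ (v : Y) := tensorIdApply_mulLeft T' a (comul (R := k) y) v
  unfold tensorIdApply at h₁ h₂ ⊢
  simp only [MultiplierHopfAlgebra.IsMiddleCover, hopf_comulMul, hopf_mulComul, h₁, h₂]
  constructor
  · intro h
    simpa using (h 1).1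
  · rintro rfl v
    simp only [← LinearMap.comp_apply, ← LinearMap.lTensor_comp, LinearMap.rTensor_comp_lTensor,
      LinearMap.lTensor_comp_rTensor, and_self]

/-! ### Covered expressions as products -/

section Covered

variable (ρ : Y →ₗ[k] A ⊗[k] Y)

/-- `y ⊗ a ↦ ρ(y)(a ⊗ 1)`. -/
def coactionMulRight : Y ⊗[k] A →ₗ[k] A ⊗[k] Y :=
  TensorProduct.lift ((LinearMap.mul k (A ⊗[k] Y)).compl₁₂ ρ ((TensorProduct.mk k A Y).flip 1))

/-- `a ⊗ y ↦ (a ⊗ 1)ρ(y)`. -/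
def coactionMulLeft : A ⊗[k] Y →ₗ[k] A ⊗[k] Y :=
  TensorProduct.lift ((LinearMap.mul k (A ⊗[k] Y)).compl₁₂ ((TensorProduct.mk k A Y).flip 1) ρ)

@[simp] theorem coactionMulRight_tmul (y : Y) (a : A) :
    coactionMulRight ρ (y ⊗ₜ a) = ρ y * (a ⊗ₜ[k] (1 : Y)) := rfl

@[simp] theorem coactionMulLeft_tmul (a : A) (y : Y) :
    coactionMulLeft ρ (a ⊗ₜ y) = (a ⊗ₜ[k] (1 : Y)) * ρ y := rfl

/-- Both sides of the defining equation of `T` lie in the image of the injective embedding, so the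
equation descends to `A ⊗ Y` and fixes `T` on pure tensors. -/
theorem of_coactionMulRight_iff (T : Y ⊗[k] A →ₗ[k] A ⊗[k] Y) :
    (∀ (y : Y) (a : A), MultiplierAlgebra.of k (A ⊗[k] Y) (T (y ⊗ₜ a))
        = (MultiplierAlgebra.of k (A ⊗[k] Y) ∘ₗ ρ) y * MultiplierAlgebra.inl Y a)
      ↔ T = coactionMulRight ρ := by
  simp only [MultiplierAlgebra.inl_eq_of, LinearMap.comp_apply, ← MultiplierAlgebra.of_mul,
    MultiplierAlgebra.of_injective.eq_iff]
  exact ⟨fun h => TensorProduct.ext' h, by rintro rfl y a; rfl⟩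

theorem of_coactionMulLeft_iff (T' : A ⊗[k] Y →ₗ[k] A ⊗[k] Y) :
    (∀ (a : A) (y : Y), MultiplierAlgebra.of k (A ⊗[k] Y) (T' (a ⊗ₜ y))
        = MultiplierAlgebra.inl Y a * (MultiplierAlgebra.of k (A ⊗[k] Y) ∘ₗ ρ) y)
      ↔ T' = coactionMulLeft ρ := by
  simp only [MultiplierAlgebra.inl_eq_of, LinearMap.comp_apply, ← MultiplierAlgebra.of_mul,
    MultiplierAlgebra.of_injective.eq_iff]
  exact ⟨fun h => TensorProduct.ext' h, by rintro rfl y a; rfl⟩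

/-! ### Compatibility with the comultiplication of `Y` -/

theorem comulMul_lTensor_mul (s : A ⊗[k] Y) (a : A) (y' : Y) :
    ((hopfMultiplierHopfAlgebra k Y).comulMul y').lTensor A (s * (a ⊗ₜ[k] (1 : Y)))
      = (comul (R := k) (A := Y)).lTensor A s * (a ⊗ₜ[k] ((1 : Y) ⊗ₜ[k] y')) := by
  induction s with
  | zero => simp
  | add s t hs ht => simp only [add_mul, map_add, hs, ht]
  | tmul b z => simp [hopf_comulMul]

theorem mulComul_lTensor_mul (s : A ⊗[k] Y) (a : A) (y' : Y) :
    ((hopfMultiplierHopfAlgebra k Y).mulComul y').lTensor A (s * (a ⊗ₜ[k] (1 : Y)))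
      = ((1 : A) ⊗ₜ[k] ((1 : Y) ⊗ₜ[k] y')) * (comul (R := k) (A := Y)).lTensor A s
        * (a ⊗ₜ[k] (1 : Y ⊗[k] Y)) := by
  induction s with
  | zero => simp
  | add s t hs ht => simp only [add_mul, mul_add, map_add, hs, ht]
  | tmul b z => simp [hopf_mulComul]

/-- `(m_A ⊗ ι ⊗ ι)(ι ⊗ τ_{Y,A} ⊗ ι)(ρ ⊗ ρ)`. -/
def coactionSq : Y ⊗[k] Y →ₗ[k] A ⊗[k] (Y ⊗[k] Y) :=
  (LinearMap.mul' k A).rTensor (Y ⊗[k] Y)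
    ∘ₗ (TensorProduct.tensorTensorTensorComm k A Y A Y).toLinearMap ∘ₗ TensorProduct.map ρ ρ

/-- For `ρ(y₍₁₎) = c ⊗ x` and `ρ(y₍₂₎) = b ⊗ z`, applying `T` to the second leg first produces `ba`,
then `cba`. The order of multiplication is that of (H2), with `a` at the right end, so commutativity
of `A` plays no role. -/
theorem rightCover_comul (y y' : Y) (a : A) :
    TensorProduct.assoc k A Y Y ((coactionMulRight ρ).rTensor Y ((TensorProduct.assoc k Y A Y).symm
        (((LinearMap.mulRight k y').lTensor A).lTensor Y
          (idTensorComul (coactionMulRight ρ) y a))))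
      = coactionSq ρ (comul y) * (a ⊗ₜ[k] ((1 : Y) ⊗ₜ[k] y')) := by
  unfold idTensorComul coactionSq
  induction comul (R := k) y with
  | zero => simp
  | add s t hs ht => simp only [add_mul, add_tmul, map_add, hs, ht]
  | tmul u v =>
    simp only [LinearMap.comp_apply, map_tmul, assoc_tmul, LinearMap.lTensor_tmul,
      coactionMulRight_tmul, LinearEquiv.coe_coe]
    induction ρ v with
    | zero => simp
    | add s t hs ht => simp only [add_mul, tmul_add, map_add, hs, ht]
    | tmul b z =>
      simp only [Algebra.TensorProduct.tmul_mul_tmul, LinearMap.lTensor_tmul, assoc_symm_tmul,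
        LinearMap.rTensor_tmul, coactionMulRight_tmul]
      induction ρ u with
      | zero => simp
      | add s t hs ht => simp only [add_mul, add_tmul, map_add, hs, ht]
      | tmul c x => simp [mul_assoc]

theorem leftCover_comul (y y' : Y) (a : A) :
    TensorProduct.assoc k A Y Y ((coactionMulRight ρ).rTensor Y ((TensorProduct.assoc k Y A Y).symm
        (((LinearMap.mulLeft k y').lTensor A).lTensor Y
          (idTensorComul (coactionMulRight ρ) y a))))
      = ((1 : A) ⊗ₜ[k] ((1 : Y) ⊗ₜ[k] y')) * coactionSq ρ (comul y)
        * (a ⊗ₜ[k] (1 : Y ⊗[k] Y)) := by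
  unfold idTensorComul coactionSq
  induction comul (R := k) y with
  | zero => simp
  | add s t hs ht => simp only [add_mul, mul_add, add_tmul, map_add, hs, ht]
  | tmul u v =>
    simp only [LinearMap.comp_apply, map_tmul, assoc_tmul, LinearMap.lTensor_tmul,
      coactionMulRight_tmul, LinearEquiv.coe_coe]
    induction ρ v with
    | zero => simp
    | add s t hs ht => simp only [add_mul, mul_add, tmul_add, map_add, hs, ht]
    | tmul b z =>
      simp only [Algebra.TensorProduct.tmul_mul_tmul, LinearMap.lTensor_tmul, assoc_symm_tmul,
        LinearMap.rTensor_tmul, coactionMulRight_tmul]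
      induction ρ u with
      | zero => simp
      | add s t hs ht => simp only [add_mul, mul_add, add_tmul, map_add, hs, ht]
      | tmul c x => simp [mul_assoc]

/-! ### Partial coassociativity -/

theorem coaction_twice_mulRight (y y' : Y) (e : A ⊗[k] A) :
    ((LinearMap.mulRight k y').lTensor A).lTensor A ((coactionMulRight ρ).lTensor A
        (TensorProduct.assoc k A Y A ((coactionMulRight ρ).rTensor A
          ((TensorProduct.assoc k Y A A).symm (y ⊗ₜ[k] e)))))
      = ρ.lTensor A (ρ y) * TensorProduct.assoc k A A Y (e ⊗ₜ[k] y') := by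
  -- Allowing an arbitrary `e` in place of `Δ(a)(1 ⊗ a')` makes the identity linear in `e`, so pure
  -- tensors suffice.
  induction e with
  | zero => simp
  | add s t hs ht => simp only [mul_add, add_tmul, tmul_add, map_add, hs, ht]
  | tmul b c =>
    simp only [assoc_symm_tmul, LinearMap.rTensor_tmul, coactionMulRight_tmul, assoc_tmul]
    induction ρ y with
    | zero => simp
    | add s t hs ht => simp only [add_mul, add_tmul, map_add, hs, ht]
    | tmul d x =>
      simp only [Algebra.TensorProduct.tmul_mul_tmul, LinearMap.lTensor_tmul, assoc_tmul,
        coactionMulRight_tmul, mul_one]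
      -- The first legs agree; what is left is `ρ(x)(c ⊗ 1)(1 ⊗ y') = ρ(x)(c ⊗ y')`.
      congr 1
      induction ρ x with
      | zero => simp
      | add s t hs ht => simp only [add_mul, map_add, hs, ht]
      | tmul f z => simp

/-- `(m_A ⊗ ι ⊗ ι){(ι ⊗ ε_Y)ρ ⊗ (Δ_A ⊗ ι)ρ}`. -/
def coactionCoassoc : Y ⊗[k] Y →ₗ[k] A ⊗[k] (A ⊗[k] Y) :=
  (LinearMap.mul' k A).rTensor (A ⊗[k] Y)
    ∘ₗ (TensorProduct.assoc k A A (A ⊗[k] Y)).symm.toLinearMap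
    ∘ₗ TensorProduct.map (idTensorCounit k A (counit (R := k) (A := Y)) ∘ₗ ρ)
        ((TensorProduct.assoc k A A Y).toLinearMap ∘ₗ (comul (R := k) (A := A)).rTensor Y ∘ₗ ρ)

theorem idTensorCounit_coactionMulRight (y : Y) (a : A) :
    idTensorCounit k A (counit (R := k) (A := Y)) (ρ y * (a ⊗ₜ[k] (1 : Y)))
      = idTensorCounit k A counit (ρ y) * a := by
  induction ρ y with
  | zero => simp
  | add s t hs ht => simp only [add_mul, map_add, hs, ht]
  | tmul b z => simp [idTensorCounit]

theorem idTensorCounit_coactionMulLeft (y : Y) (a : A) :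
    idTensorCounit k A (counit (R := k) (A := Y)) ((a ⊗ₜ[k] (1 : Y)) * ρ y)
      = a * idTensorCounit k A counit (ρ y) := by
  induction ρ y with
  | zero => simp
  | add s t hs ht => simp only [mul_add, map_add, hs, ht]
  | tmul b z => simp [idTensorCounit]

/-- Multiplicativity of `Δ_A` splits `Δ(ba)` as `Δ(b)Δ(a)`, leaving `Δ(a)(1 ⊗ a')` at the right end.
Its first leg then comes out of `(ι ⊗ ε_Y)T` by `idTensorCounit_coactionMulRight`. -/
theorem rightCover_coassoc (y y' : Y) (a a' : A) :
    (idTensorCounit k A (counit (R := k) (A := Y)) ∘ₗ coactionMulRight ρ).rTensor (A ⊗[k] Y)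
        ((TensorProduct.assoc k Y A (A ⊗[k] Y)).symm
          ((TensorProduct.assoc k A A Y).toLinearMap.lTensor Y
            ((((hopfMultiplierHopfAlgebra k A).comulMul a').rTensor Y).lTensor Y
              (((LinearMap.mulRight k y').lTensor A).lTensor Y
                (idTensorComul (coactionMulRight ρ) y a)))))
      = coactionCoassoc ρ (comul y)
        * TensorProduct.assoc k A A Y ((comul a * ((1 : A) ⊗ₜ[k] a')) ⊗ₜ[k] y') := by
  unfold idTensorComul coactionCoassoc
  induction comul (R := k) y with
  | zero => simp
  | add s t hs ht => simp only [add_mul, add_tmul, map_add, hs, ht]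
  | tmul u v =>
    simp only [LinearMap.comp_apply, map_tmul, assoc_tmul, LinearMap.lTensor_tmul,
      coactionMulRight_tmul, LinearEquiv.coe_coe]
    induction ρ v with
    | zero => simp
    | add s t hs ht => simp only [add_mul, tmul_add, map_add, hs, ht]
    | tmul b z =>
      simp only [Algebra.TensorProduct.tmul_mul_tmul, LinearMap.lTensor_tmul, LinearMap.rTensor_tmul,
        hopf_comulMul, LinearMap.mulRight_apply, mul_one, Bialgebra.comul_mul, mul_assoc]
      -- Only the position of this factor matters, so it becomes an arbitrary tensor open to
      -- induction.
      generalize comul (R := k) a * ((1 : A) ⊗ₜ[k] a') = e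
      induction comul (R := k) b with
      | zero => simp
      | add s t hs ht => simp only [add_mul, add_tmul, tmul_add, map_add, hs, ht]
      | tmul c d =>
        induction e with
        | zero => simp
        | add s t hs ht => simp only [mul_add, add_tmul, tmul_add, map_add, hs, ht]
        | tmul f g => simp [idTensorCounit_coactionMulRight, mul_assoc]

/-! ### Symmetric partial coassociativity -/

theorem coaction_twice_mulLeft (y y' : Y) (e : A ⊗[k] A) :
    ((LinearMap.mulRight k y').lTensor A).lTensor A ((coactionMulLeft ρ).lTensor A
        ((TensorProduct.comm k Y A).toLinearMap.lTensor A
          (TensorProduct.assoc k A Y A ((coactionMulLeft ρ).rTensor A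
            ((TensorProduct.assoc k A Y A).symm ((TensorProduct.comm k A Y).toLinearMap.lTensor A
              (TensorProduct.assoc k A A Y (e ⊗ₜ[k] y))))))))
      = TensorProduct.assoc k A A Y (e ⊗ₜ[k] (1 : Y)) * ρ.lTensor A (ρ y)
        * ((1 : A) ⊗ₜ[k] ((1 : A) ⊗ₜ[k] y')) := by
  induction e with
  | zero => simp
  | add s t hs ht => simp only [add_mul, add_tmul, map_add, hs, ht]
  | tmul b c =>
    simp only [assoc_symm_tmul, LinearMap.rTensor_tmul, LinearMap.lTensor_tmul, assoc_tmul,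
      LinearEquiv.coe_coe, comm_tmul, coactionMulLeft_tmul]
    induction ρ y with
    | zero => simp
    | add s t hs ht => simp only [mul_add, add_mul, add_tmul, map_add, hs, ht]
    | tmul d x =>
      simp only [Algebra.TensorProduct.tmul_mul_tmul, LinearMap.lTensor_tmul, assoc_tmul,
        LinearEquiv.coe_coe, comm_tmul, coactionMulLeft_tmul, mul_one, one_mul]
      congr 1
      induction ρ x with
      | zero => simp
      | add s t hs ht => simp only [mul_add, add_mul, map_add, hs, ht]
      | tmul f z => simp

/-- `(m_A ⊗ ι ⊗ ι)(ι ⊗ τ_{A ⊗ Y, A}){(Δ_A ⊗ ι)ρ ⊗ (ι ⊗ ε_Y)ρ}`. -/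
def coactionCoassocSymm : Y ⊗[k] Y →ₗ[k] A ⊗[k] (A ⊗[k] Y) :=
  (LinearMap.mul' k A).rTensor (A ⊗[k] Y)
    ∘ₗ (TensorProduct.assoc k A A (A ⊗[k] Y)).symm.toLinearMap
    ∘ₗ (TensorProduct.comm k (A ⊗[k] Y) A).toLinearMap.lTensor A
    ∘ₗ (TensorProduct.assoc k A (A ⊗[k] Y) A).toLinearMap
    ∘ₗ TensorProduct.map
        ((TensorProduct.assoc k A A Y).toLinearMap ∘ₗ (comul (R := k) (A := A)).rTensor Y ∘ₗ ρ)
        (idTensorCounit k A (counit (R := k) (A := Y)) ∘ₗ ρ)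

set_option maxHeartbeats 1000000 in
-- Mirror image of `rightCover_coassoc`: now `Δ(ab) = Δ(a)Δ(b)` leaves `(1 ⊗ a')Δ(a)` at the left
-- end, and the factor `(ι ⊗ ε_Y)ρ(y₍₂₎)` lands to the right of the first leg of `Δ(b)`, the order
-- found in (H4). The flip carries the middle `Y`-leg, on which `y'` acts, to the last place.
theorem middleCover_coassoc (y y' : Y) (a a' : A) :
    (idTensorCounit k A (counit (R := k) (A := Y)) ∘ₗ coactionMulLeft ρ).rTensor (A ⊗[k] Y)
        ((TensorProduct.assoc k A Y (A ⊗[k] Y)).symm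
          ((TensorProduct.comm k (A ⊗[k] Y) Y).toLinearMap.lTensor A
            (TensorProduct.assoc k A (A ⊗[k] Y) Y
              ((TensorProduct.assoc k A A Y).toLinearMap.rTensor Y
                ((((hopfMultiplierHopfAlgebra k A).mulComul a').rTensor Y).rTensor Y
                  ((TensorProduct.assoc k A Y Y).symm
                    (((LinearMap.mulRight k y').rTensor Y).lTensor A
                      (tensorIdApply (coactionMulLeft ρ) a (comul y)))))))))
      = TensorProduct.assoc k A A Y ((((1 : A) ⊗ₜ[k] a') * comul a) ⊗ₜ[k] (1 : Y))
        * coactionCoassocSymm ρ (comul y) * ((1 : A) ⊗ₜ[k] ((1 : A) ⊗ₜ[k] y')) := by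
  unfold tensorIdApply coactionCoassocSymm
  induction comul (R := k) y with
  | zero => simp
  | add s t hs ht => simp only [add_mul, mul_add, tmul_add, map_add, hs, ht]
  | tmul u v =>
    simp only [LinearMap.comp_apply, map_tmul, assoc_symm_tmul, LinearMap.rTensor_tmul,
      coactionMulLeft_tmul, LinearEquiv.coe_coe]
    induction ρ u with
    | zero => simp
    | add s t hs ht => simp only [add_mul, mul_add, add_tmul, map_add, hs, ht]
    | tmul b z =>
      simp only [Algebra.TensorProduct.tmul_mul_tmul, LinearMap.lTensor_tmul, LinearMap.rTensor_tmul,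
        assoc_tmul, assoc_symm_tmul, hopf_mulComul, LinearMap.mulRight_apply, one_mul,
        Bialgebra.comul_mul, ← mul_assoc]
      generalize ((1 : A) ⊗ₜ[k] a') * comul (R := k) a = e
      induction comul (R := k) b with
      | zero => simp
      | add s t hs ht => simp only [add_mul, mul_add, add_tmul, map_add, hs, ht]
      | tmul c d =>
        induction e with
        | zero => simp
        | add s t hs ht => simp only [add_mul, add_tmul, map_add, hs, ht]
        | tmul f g => simp [idTensorCounit_coactionMulLeft, mul_assoc]

end Covered

/-! ### The two notions agree -/

theorem isPartialCoaction_iff_hopf (ρ : Y →ₗ[k] A ⊗[k] Y) :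
    IsPartialCoaction ρ ↔
      MultiplierHopfAlgebra.IsPartialCoaction (hopfMultiplierHopfAlgebra k A)
        (hopfMultiplierHopfAlgebra k Y) (MultiplierAlgebra.of k (A ⊗[k] Y) ∘ₗ ρ) := by
  constructor
  · intro h
    have hcomul (y : Y) : (comul (R := k) (A := Y)).lTensor A (ρ y) = coactionSq ρ (comul y) :=
      LinearMap.congr_fun h.comul y
    have hcoassoc (y : Y) : ρ.lTensor A (ρ y) = coactionCoassoc ρ (comul y) :=
      LinearMap.congr_fun h.coassoc y
    refine ⟨coactionMulRight ρ, (of_coactionMulRight_iff ρ _).2 rfl, fun y => ?_,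
      fun y y' a => ⟨_, (hopf_isRightCover_iff _ _ _ _ _).2 rfl⟩,
      fun y y' a => ⟨_, (hopf_isLeftCover_iff _ _ _ _ _).2 rfl⟩,
      fun y y' a w hw => ?_, fun y y' a w hw => ?_, fun y y' a a' w hw => ?_⟩
    · exact (isExtensionValue_counitTensorId_of_iff _ _).2 (LinearMap.congr_fun h.counit y)
    · rw [(hopf_isRightCover_iff _ _ _ _ _).1 hw, rightCover_comul, coactionMulRight_tmul,
        comulMul_lTensor_mul, hcomul]
    · rw [(hopf_isLeftCover_iff _ _ _ _ _).1 hw, leftCover_comul, coactionMulRight_tmul,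
        mulComul_lTensor_mul, hcomul]
    · rw [(hopf_isRightCover_iff _ _ _ _ _).1 hw, hopf_counit, rightCover_coassoc,
        coaction_twice_mulRight, hcoassoc, hopf_comulMul]
  · rintro ⟨T, h⟩
    -- There is no freedom in `T`: its defining equation makes it `coactionMulRight ρ`.
    obtain rfl := (of_coactionMulRight_iff ρ T).1 h.spec
    refine ⟨LinearMap.ext fun y => ?_, LinearMap.ext fun y => ?_, LinearMap.ext fun y => ?_⟩
    · exact (isExtensionValue_counitTensorId_of_iff _ _).1 (h.counit y)
    -- At `a = y' = 1` the right-covered (M3) is (H2) itself.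
    · have := h.comul_right y 1 1 _ ((hopf_isRightCover_iff _ _ _ _ _).2 rfl)
      rw [rightCover_comul, coactionMulRight_tmul, comulMul_lTensor_mul] at this
      simp only [← Algebra.TensorProduct.one_def, mul_one] at this
      exact this
    -- With `a = a' = y' = 1` the extra factor is `Δ(1)(1 ⊗ 1) ⊗ 1`, the unit.
    · have := h.coassoc y 1 1 1 _ ((hopf_isRightCover_iff _ _ _ _ _).2 rfl)
      rw [hopf_counit, rightCover_coassoc, coaction_twice_mulRight, hopf_comulMul,
        Bialgebra.comul_one] at this
      have h₁ : TensorProduct.assoc k A A Y ((1 * ((1 : A) ⊗ₜ[k] (1 : A))) ⊗ₜ[k] (1 : Y)) = 1 := by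
        simp [Algebra.TensorProduct.one_def]
      rw [h₁, mul_one, mul_one] at this
      exact this

theorem isSymmPartialCoaction_iff_hopf (ρ : Y →ₗ[k] A ⊗[k] Y) :
    IsSymmPartialCoaction ρ ↔
      MultiplierHopfAlgebra.IsSymmPartialCoaction (hopfMultiplierHopfAlgebra k A)
        (hopfMultiplierHopfAlgebra k Y) (MultiplierAlgebra.of k (A ⊗[k] Y) ∘ₗ ρ) := by
  constructor
  · intro h
    have hcoassoc (y : Y) : ρ.lTensor A (ρ y) = coactionCoassocSymm ρ (comul y) :=
      LinearMap.congr_fun h.coassoc_symm y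
    refine ⟨(isPartialCoaction_iff_hopf ρ).1 h.toIsPartialCoaction, coactionMulLeft ρ,
      (of_coactionMulLeft_iff ρ _).2 rfl, fun a y y' => ⟨_, (hopf_isMiddleCover_iff _ _ _ _ _).2 rfl⟩,
      fun a a' y y' w hw => ?_⟩
    rw [(hopf_isMiddleCover_iff _ _ _ _ _).1 hw, hopf_counit, middleCover_coassoc,
      coaction_twice_mulLeft, hcoassoc, hopf_mulComul]
  · rintro ⟨hp, T', h⟩
    obtain rfl := (of_coactionMulLeft_iff ρ T').1 h.spec
    refine ⟨(isPartialCoaction_iff_hopf ρ).2 hp, LinearMap.ext fun y => ?_⟩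
    -- At `a = a' = y' = 1` both outer factors become units and (M6) reduces to (H4).
    have := h.coassoc 1 1 y 1 _ ((hopf_isMiddleCover_iff _ _ _ _ _).2 rfl)
    rw [hopf_counit, middleCover_coassoc, coaction_twice_mulLeft, hopf_mulComul,
      Bialgebra.comul_one] at this
    have h₁ : TensorProduct.assoc k A A Y ((((1 : A) ⊗ₜ[k] (1 : A)) * 1) ⊗ₜ[k] (1 : Y)) = 1 := by
      simp [Algebra.TensorProduct.one_def]
    rw [h₁] at this
    simp only [← Algebra.TensorProduct.one_def, mul_one, one_mul] at this
    exact this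

end HopfMultiplier

theorem mainTheorem7 {k : Type*} [Field k] {A : Type*} [Ring A] [HopfAlgebra k A]
    {Y : Type*} [Ring Y] [HopfAlgebra k Y] :
    Function.Bijective (fun ρ : Y →ₗ[k] A ⊗[k] Y => MultiplierAlgebra.of k (A ⊗[k] Y) ∘ₗ ρ) ∧
    (∀ ρ : Y →ₗ[k] A ⊗[k] Y,
      IsPartialCoaction ρ ↔
        MultiplierHopfAlgebra.IsPartialCoaction (hopfMultiplierHopfAlgebra k A)
          (hopfMultiplierHopfAlgebra k Y) (MultiplierAlgebra.of k (A ⊗[k] Y) ∘ₗ ρ)) ∧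
    (∀ ρ : Y →ₗ[k] A ⊗[k] Y,
      IsSymmPartialCoaction ρ ↔
        MultiplierHopfAlgebra.IsSymmPartialCoaction (hopfMultiplierHopfAlgebra k A)
          (hopfMultiplierHopfAlgebra k Y) (MultiplierAlgebra.of k (A ⊗[k] Y) ∘ₗ ρ)) ∧
    (IsPartialComoduleCoalgebra k A Y ↔
      MultiplierHopfAlgebra.IsPartialComoduleCoalgebra (hopfMultiplierHopfAlgebra k A)
        (hopfMultiplierHopfAlgebra k Y)) ∧
    (IsSymmPartialComoduleCoalgebra k A Y ↔
      MultiplierHopfAlgebra.IsSymmPartialComoduleCoalgebra (hopfMultiplierHopfAlgebra k A)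
        (hopfMultiplierHopfAlgebra k Y)) := by
  have hb := MultiplierAlgebra.bijective_of_comp (k := k) (B := A ⊗[k] Y) (V := Y)
  exact ⟨hb, isPartialCoaction_iff_hopf, isSymmPartialCoaction_iff_hopf,
    -- Surjectivity lets the existential range over all multiplier-valued maps instead of only those
    -- coming from some `ρ`.
    (exists_congr isPartialCoaction_iff_hopf).trans hb.surjective.exists.symm,
    (exists_congr isSymmPartialCoaction_iff_hopf).trans hb.surjective.exists.symm⟩
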